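/- Let $H$ be a nonzero complex Hilbert space. For $n\ge 0$ let $H^{\otimes n}$ be the $n$-fold Hilbert space tensor power of $H$ (with $H^{\otimes 0}=\mathbb C$), and let $H^{\odot n}\subseteq H^{\otimes n}$ be the closed linear span of the symmetric tensors $\sum_{\pi\in S_n} h_{\pi(1)}\otimes\cdots\otimes h_{\pi(n)}$, $h_1,\dots,h_n\in H$ (so $H^{\odot 0}=\mathbb C$). For a bounded linear operator $T$ on $H$ let $T^{\otimes n}$ be the bounded operator on $H^{\otimes n}$ with $T^{\otimes n}(h_1\otimes\cdots\otimes h_n)=Th_1\otimes\cdots\otimes Th_n$ (with $T^{\otimes 0}=I$), and let $T^{\odot n}$ be its restriction to the invariant subspace $H^{\odot n}$. If $\|T\|\le 1$, the second quantization of $T$ is the operator $\Gamma(T)=\bigoplus_{n\ge 0}T^{\otimes n}$ on the Hilbert space direct sum $\Gamma(H)=\bigoplus_{n\ge 0}H^{\otimes n}$, and the symmetric second quantization of $T$ is the operator $\Gamma^{\odot}(T)=\bigoplus_{n\ge 0}T^{\odot n}$ on the Hilbert space direct sum $\Gamma^{\odot}(H)=\bigoplus_{n\ge 0}H^{\odot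 n}$. Write $\sigma(\cdot)$ for the spectrum of a bounded operator. If $\|T\|<1$, then $$ \sigma(\Gamma^{\odot}(T))=\sigma(\Gamma(T))=\{1\}\cup\overline{\bigcup_{n\ge 1}\Bigl\{\prod_{j=1}^n\lambda_j:\ \lambda_j\in\sigma(T),\ j=1,\dots,n\Bigr\}}. $$ -/

import Mathlib

open scoped ComplexConjugate TensorProduct ComplexOrder

noncomputable section

namespace FockSpace

universe u

/-! ### Positivity facts used to equip tensor powers with their inner product -/

/-- If `‖T x‖ ≤ c ‖x‖`, then `c² ⟪f a, f b⟫ - ⟪T f a, T f b⟫` is a positive semidefinite kernel. -/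
theorem posSemidef_sub_gram {H : Type*} [NormedAddCommGroup H] [InnerProductSpace ℂ H]
    {ι : Type*} (f : ι → H) (T : H →L[ℂ] H) (c : ℝ) (hT : ∀ x, ‖T x‖ ≤ c * ‖x‖) :
    (Matrix.of fun a b => (c : ℂ) ^ 2 * inner ℂ (f a) (f b)
      - inner ℂ (T (f a)) (T (f b))).PosSemidef := by
  refine ⟨?_, fun x => ?_⟩
  · ext a b
    simp [Matrix.conjTranspose_apply]
  · have key : (x.sum fun i xi => x.sum fun j xj => star xi *
        (Matrix.of fun a b => (c : ℂ) ^ 2 * inner ℂ (f a) (f b)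
          - inner ℂ (T (f a)) (T (f b))) i j * xj)
        = (((c * ‖x.sum fun i xi => xi • f i‖) ^ 2
          - ‖T (x.sum fun i xi => xi • f i)‖ ^ 2 : ℝ) : ℂ) := by
      have hn : ∀ y : H, ((‖y‖ : ℝ) : ℂ) ^ 2 = inner ℂ y y := fun y =>
        (inner_self_eq_norm_sq_to_K (𝕜 := ℂ) y).symm
      push_cast
      rw [mul_pow, hn, hn]
      simp only [Finsupp.sum, map_sum, sum_inner, inner_sum, Finset.mul_sum,
        ← Finset.sum_sub_distrib, map_smul, inner_smul_left, inner_smul_right, Matrix.of_apply]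
      rw [Finset.sum_comm]
      refine Finset.sum_congr rfl fun i _ => Finset.sum_congr rfl fun j _ => ?_
      simp only [RCLike.star_def]
      ring
    rw [key]
    have := hT (x.sum fun i xi => xi • f i)
    exact_mod_cast sub_nonneg.2 (pow_le_pow_left₀ (norm_nonneg _) this 2)

theorem posSemidef_gram {H : Type*} [NormedAddCommGroup H] [InnerProductSpace ℂ H]
    {ι : Type*} (f : ι → H) :
    (Matrix.of fun a b => inner ℂ (f a) (f b)).PosSemidef := by
  simpa using posSemidef_sub_gram f 0 1 (by simp)

/-- Entrywise products of positive semidefinite kernels are positive semidefinite, and they are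
monotone in each factor. -/
theorem posSemidef_prod {κ : Type*} {ι : Type*} (s : Finset κ) (A B : κ → ι → ι → ℂ)
    (hA : ∀ k, (Matrix.of (A k)).PosSemidef)
    (hAB : ∀ k, (Matrix.of fun a b => B k a b - A k a b).PosSemidef) :
    (Matrix.of fun a b => ∏ k ∈ s, A k a b).PosSemidef ∧
    (Matrix.of fun a b => ∏ k ∈ s, B k a b - ∏ k ∈ s, A k a b).PosSemidef := by
  classical
  have hB : ∀ k, (Matrix.of (B k)).PosSemidef := fun k => by
    have h : Matrix.of (B k) = (Matrix.of fun a b => B k a b - A k a b) + Matrix.of (A k) := by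
      ext a b; simp
    rw [h]
    exact (hAB k).add (hA k)
  have hone : (Matrix.of fun _ _ : ι => (1 : ℂ)).PosSemidef := by
    simpa using posSemidef_gram (fun _ : ι => (1 : ℂ))
  have hprod : ∀ (C : κ → ι → ι → ℂ), (∀ k, (Matrix.of (C k)).PosSemidef) → ∀ s : Finset κ,
      (Matrix.of fun a b => ∏ k ∈ s, C k a b).PosSemidef := by
    intro C hC s
    induction s using Finset.induction_on with
    | empty => simpa using hone
    | insert k s hk ih =>
      have h : (Matrix.of fun a b => ∏ k ∈ insert k s, C k a b)
          = (Matrix.of (C k)).hadamard (Matrix.of fun a b => ∏ k ∈ s, C k a b) := by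
        ext a b; simp [Finset.prod_insert hk]
      rw [h]
      exact (hC k).hadamard ih
  refine ⟨hprod A hA s, ?_⟩
  induction s using Finset.induction_on with
  | empty =>
    have h : (Matrix.of fun a b => ∏ k ∈ ∅, B k a b - ∏ k ∈ ∅, A k a b) = (0 : Matrix ι ι ℂ) := by
      ext a b; simp
    rw [h]
    exact Matrix.PosSemidef.zero
  | insert k s hk ih =>
    have h : (Matrix.of fun a b => ∏ k ∈ insert k s, B k a b - ∏ k ∈ insert k s, A k a b)
        = (Matrix.of fun a b => B k a b - A k a b).hadamard (Matrix.of fun a b => ∏ k ∈ s, B k a b)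
          + (Matrix.of (A k)).hadamard
            (Matrix.of fun a b => ∏ k ∈ s, B k a b - ∏ k ∈ s, A k a b) := by
      ext a b
      simp [Finset.prod_insert hk]
      ring
    rw [h]
    exact ((hAB k).hadamard (hprod B hB s)).add ((hA k).hadamard ih)

/-! ### Hilbert tensor powers -/

/-- The algebraic `n`-fold tensor power `H ⊗ ⋯ ⊗ H`. It is a separate type so that it can carry the
inner product `⟪v₁ ⊗ ⋯ ⊗ vₙ, w₁ ⊗ ⋯ ⊗ wₙ⟫ = ∏ ⟪vᵢ, wᵢ⟫`. -/
def AlgTensorPower (H : Type u) [NormedAddCommGroup H] [InnerProductSpace ℂ H] (n : ℕ) : Type u :=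
  PiTensorProduct ℂ (fun _ : Fin n => H)

namespace AlgTensorPower

variable {H : Type u} [NormedAddCommGroup H] [InnerProductSpace ℂ H] {n : ℕ}

instance : AddCommGroup (AlgTensorPower H n) :=
  PiTensorProduct.instAddCommGroup (R := ℂ) (s := fun _ : Fin n => H)

instance : Module ℂ (AlgTensorPower H n) :=
  PiTensorProduct.instModule (R := ℂ) (s := fun _ : Fin n => H)

/-- The elementary tensor `v₁ ⊗ ⋯ ⊗ vₙ`. -/
def tmul : MultilinearMap ℂ (fun _ : Fin n => H) (AlgTensorPower H n) :=
  PiTensorProduct.tprod ℂ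

/-- The linear map on the tensor power induced by a multilinear map. -/
def lift {E : Type*} [AddCommGroup E] [Module ℂ E]
    (φ : MultilinearMap ℂ (fun _ : Fin n => H) E) : AlgTensorPower H n →ₗ[ℂ] E :=
  PiTensorProduct.lift φ

@[simp] theorem lift_tmul {E : Type*} [AddCommGroup E] [Module ℂ E]
    (φ : MultilinearMap ℂ (fun _ : Fin n => H) E) (v : Fin n → H) : lift φ (tmul v) = φ v :=
  PiTensorProduct.lift.tprod v

theorem hom_ext {E : Type*} [AddCommGroup E] [Module ℂ E] {f g : AlgTensorPower H n →ₗ[ℂ] E}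
    (h : ∀ v, f (tmul v) = g (tmul v)) : f = g :=
  PiTensorProduct.ext (MultilinearMap.ext h)

/-- Every tensor is a finite linear combination of elementary tensors. -/
theorem exists_finsupp (x : AlgTensorPower H n) :
    ∃ c : (Fin n → H) →₀ ℂ, (c.sum fun v a => a • tmul v) = x := by
  have h : Submodule.span ℂ (Set.range (tmul (H := H) (n := n))) = ⊤ :=
    PiTensorProduct.span_tprod_eq_top (R := ℂ) (s := fun _ : Fin n => H)
  exact Finsupp.mem_span_range_iff_exists_finsupp.1 (h ▸ Submodule.mem_top)

/-- The linear functional `w₁ ⊗ ⋯ ⊗ wₙ ↦ ∏ ⟪vᵢ, wᵢ⟫`. -/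
def functional (v : Fin n → H) : AlgTensorPower H n →ₗ[ℂ] ℂ :=
  lift ((MultilinearMap.mkPiAlgebra ℂ (Fin n) ℂ).compLinearMap fun i => innerₛₗ ℂ (v i))

@[simp] theorem functional_tmul (v w : Fin n → H) :
    functional v (tmul w) = ∏ i, inner ℂ (v i) (w i) := by
  simp [functional]

/-- The form, linear in the first and conjugate linear in the second variable, with
`(v₁ ⊗ ⋯ ⊗ vₙ, w₁ ⊗ ⋯ ⊗ wₙ) ↦ conj (∏ ⟪vᵢ, wᵢ⟫)`. -/
def conjForm : AlgTensorPower H n →ₗ[ℂ] AlgTensorPower H n →ₗ⋆[ℂ] ℂ :=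
  lift
    { toFun := fun v =>
        { toFun := fun x => conj (functional v x)
          map_add' := fun x y => by simp
          map_smul' := fun a x => by simp }
      map_update_add' := fun v i x y => by
        have h : functional (Function.update v i (x + y))
            = functional (Function.update v i x) + functional (Function.update v i y) := by
          refine hom_ext fun w => ?_
          simp only [LinearMap.add_apply, functional_tmul]
          rw [← Finset.mul_prod_erase _ _ (Finset.mem_univ i),
            ← Finset.mul_prod_erase _ _ (Finset.mem_univ i),
            ← Finset.mul_prod_erase _ _ (Finset.mem_univ i)]
          have h' : ∀ z : H, ∏ k ∈ Finset.univ.erase i,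
              inner ℂ (Function.update v i z k) (w k)
              = ∏ k ∈ Finset.univ.erase i, inner ℂ (v k) (w k) := fun z =>
            Finset.prod_congr rfl fun k hk => by
              rw [Function.update_of_ne (Finset.ne_of_mem_erase hk)]
          simp only [h', Function.update_self, inner_add_left, add_mul]
        ext z
        simp [h]
      map_update_smul' := fun v i a x => by
        have h : functional (Function.update v i (a • x))
            = conj a • functional (Function.update v i x) := by
          refine hom_ext fun w => ?_
          simp only [LinearMap.smul_apply, functional_tmul]
          rw [← Finset.mul_prod_erase _ _ (Finset.mem_univ i),
            ← Finset.mul_prod_erase _ _ (Finset.mem_univ i)]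
          have h' : ∀ z : H, ∏ k ∈ Finset.univ.erase i,
              inner ℂ (Function.update v i z k) (w k)
              = ∏ k ∈ Finset.univ.erase i, inner ℂ (v k) (w k) := fun z =>
            Finset.prod_congr rfl fun k hk => by
              rw [Function.update_of_ne (Finset.ne_of_mem_erase hk)]
          simp only [h', Function.update_self, inner_smul_left, smul_eq_mul, mul_assoc]
        ext z
        simp [h] }

@[simp] theorem conjForm_tmul (v w : Fin n → H) :
    conjForm (tmul v) (tmul w) = conj (∏ i, inner ℂ (v i) (w i)) := by
  rw [← functional_tmul, conjForm, lift_tmul]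
  rfl

theorem conj_conjForm_sum (c d : (Fin n → H) →₀ ℂ) (f g : (Fin n → H) → Fin n → H) :
    conj (conjForm (c.sum fun v a => a • tmul (f v)) (d.sum fun v a => a • tmul (g v)))
      = c.sum fun v a => d.sum fun w b => star a * (∏ i, inner ℂ (f v i) (g w i)) * b := by
  simp only [Finsupp.sum, map_sum, LinearMap.sum_apply, map_smul, LinearMap.smul_apply, map_smulₛₗ,
    conjForm_tmul, smul_eq_mul, map_mul, RCLike.star_def, Complex.conj_conj, Finset.mul_sum]
  rw [Finset.sum_comm]
  refine Finset.sum_congr rfl fun i _ => Finset.sum_congr rfl fun j _ => ?_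
  ring

/-- The inner product on the algebraic tensor power, determined by
`⟪v₁ ⊗ ⋯ ⊗ vₙ, w₁ ⊗ ⋯ ⊗ wₙ⟫ = ∏ ⟪vᵢ, wᵢ⟫` and sesquilinearity. -/
instance instCore : PreInnerProductSpace.Core ℂ (AlgTensorPower H n) where
  inner x y := conj (conjForm x y)
  conj_inner_symm x y := by
    obtain ⟨c, rfl⟩ := exists_finsupp x
    obtain ⟨d, rfl⟩ := exists_finsupp y
    rw [conj_conjForm_sum d c (fun v => v) (fun v => v), conj_conjForm_sum c d (fun v => v) (fun v => v), Finsupp.sum_comm]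
    simp only [Finsupp.sum, map_sum, map_mul, map_prod, inner_conj_symm, RCLike.star_def,
      Complex.conj_conj]
    refine Finset.sum_congr rfl fun i _ => Finset.sum_congr rfl fun j _ => ?_
    ring
  re_inner_nonneg x := by
    obtain ⟨c, rfl⟩ := exists_finsupp x
    rw [conj_conjForm_sum c c (fun v => v) (fun v => v)]
    have h := (posSemidef_prod (κ := Fin n) Finset.univ
      (fun k (v w : Fin n → H) => inner ℂ (v k) (w k)) (fun k v w => inner ℂ (v k) (w k))
      (fun k => posSemidef_gram fun v : Fin n → H => v k)
      (fun k => by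
        simp only [sub_self]
        exact Matrix.PosSemidef.zero)).1
    exact (Complex.nonneg_iff.1 (h.2 c)).1
  add_left x y z := by simp
  smul_left x y r := by simp

instance : SeminormedAddCommGroup (AlgTensorPower H n) :=
  InnerProductSpace.Core.toSeminormedAddCommGroup (𝕜 := ℂ)

instance : InnerProductSpace ℂ (AlgTensorPower H n) := .ofCore _

theorem inner_tmul (v w : Fin n → H) :
    inner ℂ (tmul v) (tmul w) = ∏ i, inner ℂ (v i) (w i) := by
  change conj (conjForm (tmul v) (tmul w)) = _
  simp

/-- The linear map `v₁ ⊗ ⋯ ⊗ vₙ ↦ T v₁ ⊗ ⋯ ⊗ T vₙ`. -/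
def mapₗ (T : H →L[ℂ] H) : AlgTensorPower H n →ₗ[ℂ] AlgTensorPower H n :=
  lift (tmul.compLinearMap fun _ => (T : H →ₗ[ℂ] H))

@[simp] theorem mapₗ_tmul (T : H →L[ℂ] H) (v : Fin n → H) :
    mapₗ T (tmul v) = tmul fun i => T (v i) := by
  simp [mapₗ]

theorem norm_mapₗ_le (T : H →L[ℂ] H) (x : AlgTensorPower H n) :
    ‖mapₗ T x‖ ≤ ‖T‖ ^ n * ‖x‖ := by
  have hsq : ‖mapₗ T x‖ ^ 2 ≤ (‖T‖ ^ n * ‖x‖) ^ 2 := by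
    rw [mul_pow, InnerProductSpace.norm_sq_eq_re_inner (𝕜 := ℂ) x,
      InnerProductSpace.norm_sq_eq_re_inner (𝕜 := ℂ) (mapₗ T x)]
    change RCLike.re (conj (conjForm (mapₗ T x) (mapₗ T x)))
      ≤ (‖T‖ ^ n) ^ 2 * RCLike.re (conj (conjForm x x))
    obtain ⟨c, rfl⟩ := exists_finsupp x
    have hmap : mapₗ T (c.sum fun v a => a • tmul v)
        = c.sum fun v a => a • tmul (fun i => T (v i)) := by
      simp [Finsupp.sum, map_sum]
    rw [hmap, conj_conjForm_sum c c (fun v i => T (v i)) (fun v i => T (v i)),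
      conj_conjForm_sum c c (fun v => v) (fun v => v)]
    have h := (posSemidef_prod (κ := Fin n) Finset.univ
      (fun k (v w : Fin n → H) => inner ℂ (T (v k)) (T (w k)))
      (fun k v w => (‖T‖ : ℂ) ^ 2 * inner ℂ (v k) (w k))
      (fun k => posSemidef_gram fun v : Fin n → H => T (v k))
      (fun k => posSemidef_sub_gram (fun v : Fin n → H => v k) T ‖T‖
        T.le_opNorm)).2
    have h2 := (Complex.nonneg_iff.1 (h.2 c)).1
    have h3 : (c.sum fun v a => c.sum fun w b => star a *
        (Matrix.of fun a b : Fin n → H => ∏ k, (‖T‖ : ℂ) ^ 2 * inner ℂ (a k) (b k)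
          - ∏ k, inner ℂ (T (a k)) (T (b k))) v w * b)
        = (((‖T‖ ^ n) ^ 2 : ℝ) : ℂ) * (c.sum fun v a => c.sum fun w b =>
            star a * (∏ i, inner ℂ (v i) (w i)) * b)
          - c.sum fun v a => c.sum fun w b =>
            star a * (∏ i, inner ℂ (T (v i)) (T (w i))) * b := by
      simp only [Finsupp.sum, Finset.mul_sum, ← Finset.sum_sub_distrib, Matrix.of_apply,
        Finset.prod_mul_distrib, Finset.prod_const, Finset.card_univ, Fintype.card_fin]
      refine Finset.sum_congr rfl fun i _ => Finset.sum_congr rfl fun j _ => ?_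
      push_cast
      ring
    rw [h3, Complex.sub_re, Complex.re_ofReal_mul] at h2
    exact sub_nonneg.1 h2
  exact (pow_le_pow_iff_left₀ (norm_nonneg _) (by positivity) two_ne_zero).1 hsq

/-- `mapₗ T` as a bounded operator. -/
def map (T : H →L[ℂ] H) : AlgTensorPower H n →L[ℂ] AlgTensorPower H n :=
  (mapₗ T).mkContinuous (‖T‖ ^ n) (norm_mapₗ_le T)

end AlgTensorPower

/-- The Hilbert tensor power `H^{⊗n}`: the completion of the algebraic tensor power. For `n = 0` it
is one-dimensional, spanned by the (unit) empty tensor, that is, it is `ℂ`. -/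
abbrev TensorPower (H : Type u) [NormedAddCommGroup H] [InnerProductSpace ℂ H] (n : ℕ) : Type u :=
  UniformSpace.Completion (AlgTensorPower H n)

section

variable {H : Type u} [NormedAddCommGroup H] [InnerProductSpace ℂ H]

/-- The elementary tensor `v₁ ⊗ ⋯ ⊗ vₙ` in the Hilbert tensor power. -/
def elemTensor {n : ℕ} (v : Fin n → H) : TensorPower H n :=
  ((AlgTensorPower.tmul v : AlgTensorPower H n) : TensorPower H n)

/-- The operator `T^{⊗n}` on `H^{⊗n}`, with `T^{⊗n} (v₁ ⊗ ⋯ ⊗ vₙ) = T v₁ ⊗ ⋯ ⊗ T vₙ`. -/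
def tensorPowerMap (T : H →L[ℂ] H) (n : ℕ) : TensorPower H n →L[ℂ] TensorPower H n :=
  (AlgTensorPower.map T).completion

theorem inner_elemTensor {n : ℕ} (v w : Fin n → H) :
    inner ℂ (elemTensor v) (elemTensor w) = ∏ i, inner ℂ (v i) (w i) := by
  rw [elemTensor, elemTensor, UniformSpace.Completion.inner_coe, AlgTensorPower.inner_tmul]

theorem tensorPowerMap_elemTensor (T : H →L[ℂ] H) {n : ℕ} (v : Fin n → H) :
    tensorPowerMap T n (elemTensor v) = elemTensor fun i => T (v i) := by
  rw [elemTensor, tensorPowerMap, ContinuousLinearMap.completion_apply_coe]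
  exact congrArg _ (AlgTensorPower.mapₗ_tmul T v)

theorem norm_tensorPowerMap_le (T : H →L[ℂ] H) (n : ℕ) : ‖tensorPowerMap T n‖ ≤ ‖T‖ ^ n := by
  refine ContinuousLinearMap.opNorm_le_bound _ (by positivity) fun x => ?_
  induction x using UniformSpace.Completion.induction_on with
  | hp => exact isClosed_le (by fun_prop) (by fun_prop)
  | ih x =>
    rw [tensorPowerMap, ContinuousLinearMap.completion_apply_coe, UniformSpace.Completion.norm_coe,
      UniformSpace.Completion.norm_coe]
    exact AlgTensorPower.norm_mapₗ_le T x

theorem norm_tensorPowerMap_le_one {T : H →L[ℂ] H} (hT : ‖T‖ ≤ 1) (n : ℕ) :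
    ‖tensorPowerMap T n‖ ≤ 1 :=
  (norm_tensorPowerMap_le T n).trans (pow_le_one₀ (norm_nonneg _) hT)

/-- The elementary symmetric `n`-tensor `∑_σ v_{σ(1)} ⊗ ⋯ ⊗ v_{σ(n)}`, the sum running over all
permutations `σ` of the indices. -/
def symTensor {n : ℕ} (v : Fin n → H) : TensorPower H n :=
  ∑ σ : Equiv.Perm (Fin n), elemTensor fun i => v (σ i)

end

/-- The symmetric Hilbert tensor power: the closed subspace of `H^{⊗n}` spanned by the symmetric
tensors. -/
def symTensorPower (H : Type u) [NormedAddCommGroup H] [InnerProductSpace ℂ H] (n : ℕ) :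
    Submodule ℂ (TensorPower H n) :=
  (Submodule.span ℂ (Set.range (symTensor (H := H) (n := n)))).topologicalClosure

section

variable {H : Type u} [NormedAddCommGroup H] [InnerProductSpace ℂ H]

theorem tensorPowerMap_mem_symTensorPower (T : H →L[ℂ] H) (n : ℕ) :
    ∀ x ∈ symTensorPower H n, tensorPowerMap T n x ∈ symTensorPower H n := by
  have hmap : (Submodule.span ℂ (Set.range (symTensor (H := H) (n := n)))) ≤
      (Submodule.span ℂ (Set.range (symTensor (H := H) (n := n)))).comap
        (tensorPowerMap T n : TensorPower H n →ₗ[ℂ] TensorPower H n) := by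
    rw [Submodule.span_le]
    rintro _ ⟨v, rfl⟩
    refine Submodule.subset_span ⟨fun i => T (v i), ?_⟩
    simp [symTensor, map_sum, tensorPowerMap_elemTensor]
  intro x hx
  exact map_mem_closure (tensorPowerMap T n).continuous hx fun y hy => hmap hy

/-- The operator `T^{⊙n}`: the restriction of `T^{⊗n}` to the symmetric tensor power. -/
def symTensorPowerMap (T : H →L[ℂ] H) (n : ℕ) : symTensorPower H n →L[ℂ] symTensorPower H n :=
  (tensorPowerMap T n).restrict (tensorPowerMap_mem_symTensorPower T n)

theorem norm_symTensorPowerMap_le_one {T : H →L[ℂ] H} (hT : ‖T‖ ≤ 1) (n : ℕ) :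
    ‖symTensorPowerMap T n‖ ≤ 1 :=
  ContinuousLinearMap.opNorm_le_bound _ zero_le_one fun x =>
    (tensorPowerMap T n).le_of_opNorm_le (norm_tensorPowerMap_le_one hT n) (x : TensorPower H n)

end

/-! ### Fock spaces and second quantization -/

/-- The Fock space over `H`: the Hilbert space direct sum of all `H^{⊗n}`, `n ≥ 0`. -/
abbrev Fock (H : Type u) [NormedAddCommGroup H] [InnerProductSpace ℂ H] : Type u :=
  lp (fun n : ℕ => TensorPower H n) 2

/-- The symmetric Fock space over `H`: the Hilbert space direct sum of all symmetric tensor powers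
of `H`. -/
abbrev SymFock (H : Type u) [NormedAddCommGroup H] [InnerProductSpace ℂ H] : Type u :=
  lp (fun n : ℕ => symTensorPower H n) 2

section

variable {H : Type u} [NormedAddCommGroup H] [InnerProductSpace ℂ H]

/-- The second quantization of a contraction `T`: the direct sum of the operators `T^{⊗n}`,
`n ≥ 0`, acting on the Fock space. -/
def secondQuantization (T : H →L[ℂ] H) (hT : ‖T‖ ≤ 1) : Fock H →L[ℂ] Fock H :=
  lp.mapCLM 2 (fun n => tensorPowerMap T n) zero_le_one (norm_tensorPowerMap_le_one hT)

/-- The symmetric second quantization of a contraction `T`: the direct sum of the operators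
`T^{⊙n}`, `n ≥ 0`, acting on the symmetric Fock space. -/
def symSecondQuantization (T : H →L[ℂ] H) (hT : ‖T‖ ≤ 1) : SymFock H →L[ℂ] SymFock H :=
  lp.mapCLM 2 (fun n => symTensorPowerMap T n) zero_le_one (norm_symTensorPowerMap_le_one hT)

end

end FockSpace

end

/-! The heart of the matter is that, for every n, `T^{⊗n}` and `T^{⊙n}` both have as spectrum the
set of n-fold products of points of σ(T). This follows from a cycle of inclusions: products ⊆
σ(T^{⊙n}) ⊆ σ(T^{⊗n}) ⊆ products.

The last inclusion is Gelfand theory: `T^{⊗n}` is a product of commuting operators, each acting on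
one tensor slot with spectrum inside σ(T) (`exists_prod_of_mem_spectrum_noncommProd`). The middle
one holds because the symmetrizer is a projection commuting with `T^{⊗n}`.

The first is the delicate one. If all factors are approximate eigenvalues of T, symmetrizing the
tensor product of approximate eigenvectors gives an approximate eigenvector of `T^{⊙n}`, provided
the symmetrization is not small (`exists_pos_le_norm_symTensor`). In general some factors may be
approximate eigenvalues only of the adjoint, after conjugation. But `exists_prod_eq_frontier`
rewrites a nonzero product so that at most one factor is interior to σ(T); frontier points are of
both kinds, so the one remaining factor decides whether to use T or its adjoint.

In the direct sum, ‖T^{⊗n}‖ ≤ ‖T‖ⁿ → 0 gives uniform bounds on the tail of the resolvents away from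
0. The point 0 is a limit of powers of any point of σ(T), and the summand n = 0 contributes {1}. -/

noncomputable section

namespace FockSpace

universe u

/-! ### Products of commuting elements and an invertibility criterion -/

/-- In a complex Banach algebra, the spectrum of a product of commuting elements consists of
products of points of their spectra. -/
theorem exists_prod_of_mem_spectrum_noncommProd {A : Type*} [NormedRing A] [NormedAlgebra ℂ A]
    [CompleteSpace A] {ι : Type*} [Fintype ι] (a : ι → A)
    (hcomm : ∀ i j, Commute (a i) (a j)) {z : ℂ}
    (hz : z ∈ spectrum ℂ (Finset.univ.noncommProd a fun i _ j _ _ => hcomm i j)) :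
    ∃ l : ι → ℂ, (∀ i, l i ∈ spectrum ℂ (a i)) ∧ z = ∏ i, l i := by
  -- The double commutant is closed, commutative and contains inverses of its invertible elements.
  -- Spectra may therefore be computed in it, where they are the values of characters, and
  -- characters are multiplicative.
  let C : Subalgebra ℂ A :=
    Subalgebra.centralizer ℂ (Subalgebra.centralizer ℂ (Set.range a) : Set A)
  have hC : ∀ x ∈ C, ∀ y ∈ C, x * y = y * x :=
    Set.centralizer_centralizer_comm_of_comm (by
      rintro _ ⟨i, rfl⟩ _ ⟨j, rfl⟩
      exact hcomm i j)
  have hclosed : IsClosed (C : Set A) := Set.isClosed_centralizer _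
  let _ : NormedCommRing C :=
    { (inferInstance : NormedRing C) with
      mul_comm := fun x y => Subtype.ext (hC x x.2 y y.2) }
  have : CompleteSpace C := hclosed.completeSpace_coe
  have hspec : ∀ x : C, spectrum ℂ (x : A) = spectrum ℂ x := by
    intro x
    refine Set.Subset.antisymm (spectrum.subset_subalgebra x) fun w hw => ?_
    rw [spectrum.mem_iff] at hw ⊢
    refine fun h => hw ?_
    obtain ⟨u, hu⟩ := h
    have hmem : (u : A) ∈ C := by
      rw [hu]
      exact C.sub_mem (C.algebraMap_mem w) x.2
    have hinv : ((u⁻¹ : Aˣ) : A) ∈ C := by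
      rw [Subalgebra.mem_centralizer_iff] at hmem ⊢
      exact fun g hg => (Commute.units_inv_right (show Commute g u from hmem g hg))
    refine ⟨⟨⟨u, hmem⟩, ⟨_, hinv⟩, Subtype.ext u.mul_inv, Subtype.ext u.inv_mul⟩, ?_⟩
    exact Subtype.ext hu
  have hmem : ∀ i, a i ∈ C := fun i => Set.subset_centralizer_centralizer ⟨i, rfl⟩
  let b : ι → C := fun i => ⟨a i, hmem i⟩
  have hb : ((∏ i, b i : C) : A) = Finset.univ.noncommProd a fun i _ j _ _ => hcomm i j := by
    rw [← Finset.noncommProd_eq_prod]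
    exact Finset.map_noncommProd Finset.univ b _ C.val
  rw [← hb, hspec, WeakDual.CharacterSpace.mem_spectrum_iff_exists] at hz
  obtain ⟨f, hf⟩ := hz
  refine ⟨fun i => f (b i), fun i => ?_, ?_⟩
  · rw [show a i = ((b i : C) : A) from rfl, hspec]
    exact AlgHom.apply_mem_spectrum f (b i)
  · rw [← hf, map_prod]

/-- A bounded operator on a Hilbert space which is bounded below along with its adjoint is
invertible. -/
theorem isUnit_of_bounded_below {E : Type*} [NormedAddCommGroup E] [InnerProductSpace ℂ E]
    [CompleteSpace E] {A : E →L[ℂ] E} {c : ℝ} (hc : 0 < c) (h : ∀ x, c * ‖x‖ ≤ ‖A x‖)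
    (h' : ∀ x, c * ‖x‖ ≤ ‖A.adjoint x‖) : IsUnit A := by
  rw [ContinuousLinearMap.isUnit_iff_bijective]
  have hanti : AntilipschitzWith (Real.toNNReal c⁻¹) A := by
    refine A.antilipschitz_of_bound fun x => ?_
    rw [Real.coe_toNNReal _ (inv_nonneg.2 hc.le), inv_mul_eq_div, le_div_iff₀ hc, mul_comm]
    exact h x
  refine ⟨hanti.injective, ?_⟩
  have hker : A.adjoint.ker = ⊥ := by
    rw [Submodule.eq_bot_iff]
    intro x hx
    have h1 := h' x
    rw [show A.adjoint x = 0 from hx, norm_zero] at h1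
    exact norm_le_zero_iff.1 (nonpos_of_mul_nonpos_right h1 hc)
  -- The lower bound on A makes the range closed; its orthogonal complement is the kernel of the
  -- adjoint, which is trivial.
  have hclosed : IsClosed (A.range : Set E) := hanti.isClosed_range A.uniformContinuous
  have hr := A.orthogonal_range
  rw [hker] at hr
  have : CompleteSpace A.range := hclosed.completeSpace_coe
  have htop := (Submodule.orthogonal_eq_bot_iff (K := A.range)).1 hr
  exact LinearMap.range_eq_top.1 htop

/-! ### The approximate point spectrum -/

section ApproximatePointSpectrum

variable {E : Type*} [NormedAddCommGroup E] [NormedSpace ℂ E]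

/-- The approximate point spectrum of an operator: the points `z` for which `A - z` is not bounded
below. -/
def approxPointSpectrum (A : E →L[ℂ] E) : Set ℂ :=
  {z | ∀ ε > 0, ∃ x, ‖x‖ = 1 ∧ ‖A x - z • x‖ < ε}

theorem exists_bounded_below_of_notMem {A : E →L[ℂ] E} {z : ℂ} (hz : z ∉ approxPointSpectrum A) :
    ∃ ε > 0, ∀ x, ε * ‖x‖ ≤ ‖A x - z • x‖ := by
  simp only [approxPointSpectrum, Set.mem_ofPred_eq, not_forall, not_exists, not_and, not_lt] at hz
  obtain ⟨ε, hε, h⟩ := hz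
  refine ⟨ε, hε, fun x => ?_⟩
  rcases eq_or_ne x 0 with rfl | hx
  · simp
  · have hn : ‖x‖ ≠ 0 := norm_ne_zero_iff.2 hx
    have h1 := h (((‖x‖⁻¹ : ℝ) : ℂ) • x) (by rw [norm_smul]; simp [hn])
    rw [map_smul, smul_comm z, ← smul_sub, norm_smul, Complex.norm_real, Real.norm_eq_abs,
      abs_inv, abs_norm, inv_mul_eq_div, le_div_iff₀ (norm_pos_iff.2 hx)] at h1
    exact h1

/-- A quantitative criterion for membership in the spectrum. -/
theorem mem_spectrum_of_approx {A : E →L[ℂ] E} {z : ℂ} {c C : ℝ} (hc : 0 < c)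
    (h : ∀ ε > 0, ∃ x, c ≤ ‖x‖ ∧ ‖A x - z • x‖ ≤ C * ε) : z ∈ spectrum ℂ A := by
  rw [spectrum.mem_iff]
  rintro ⟨u, hu⟩
  set B : E →L[ℂ] E := ((u⁻¹ : (E →L[ℂ] E)ˣ) : E →L[ℂ] E) with hB
  -- This ε makes ‖B‖ · C · ε at most c / 2, contradicting c ≤ ‖x‖ ≤ ‖B‖ · ‖A x - z • x‖. The added
  -- ones keep the denominator positive.
  obtain ⟨x, hx, hxe⟩ := h (c / (2 * (|C| + 1) * (‖B‖ + 1))) (by positivity)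
  have h1 : ‖x‖ ≤ ‖B‖ * ‖A x - z • x‖ := by
    have h2 : B ((u : E →L[ℂ] E) x) = x := DFunLike.congr_fun u.inv_mul x
    have h3 : ‖(u : E →L[ℂ] E) x‖ = ‖A x - z • x‖ := by
      rw [hu, sub_apply, Algebra.algebraMap_eq_smul_one, smul_apply,
        one_apply_eq_self, norm_sub_rev]
    calc ‖x‖ = ‖B ((u : E →L[ℂ] E) x)‖ := by rw [h2]
      _ ≤ _ := by rw [← h3]; exact B.le_opNorm _
  have h4 : ‖B‖ * ‖A x - z • x‖ ≤ (‖B‖ + 1) * ((|C| + 1) * (c / (2 * (|C| + 1) * (‖B‖ + 1)))) := by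
    gcongr
    · linarith
    · refine hxe.trans ?_
      gcongr
      linarith [le_abs_self C]
  have h5 : (‖B‖ + 1) * ((|C| + 1) * (c / (2 * (|C| + 1) * (‖B‖ + 1)))) = c / 2 := by
    field_simp
  linarith

variable [CompleteSpace E]

/-- If `A - z` is bounded below, the resolvent stays bounded at resolvent points w near z. Its ball
of invertibility around `w - A` then has radius independent of w and reaches `z - A`, so z cannot be
in the spectrum. -/
theorem frontier_spectrum_subset_approxPointSpectrum (A : E →L[ℂ] E) :
    frontier (spectrum ℂ A) ⊆ approxPointSpectrum A := by
  intro z hz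
  by_contra hn
  obtain ⟨ε, hε, h⟩ := exists_bounded_below_of_notMem hn
  have hz1 : z ∈ spectrum ℂ A := (spectrum.isClosed A).frontier_subset hz
  have hz2 : z ∈ closure (spectrum ℂ A)ᶜ := frontier_subset_closure (by rwa [frontier_compl])
  obtain ⟨w, hw, hzw⟩ := Metric.mem_closure_iff.1 hz2 (ε / 3) (by positivity)
  rw [Set.mem_compl_iff, spectrum.notMem_iff] at hw
  obtain ⟨u, hu⟩ := hw
  have hbound : ‖((u⁻¹ : (E →L[ℂ] E)ˣ) : E →L[ℂ] E)‖ ≤ 2 / ε := by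
    refine ContinuousLinearMap.opNorm_le_bound _ (by positivity) fun y => ?_
    set x := ((u⁻¹ : (E →L[ℂ] E)ˣ) : E →L[ℂ] E) y with hx
    have hy : y = w • x - A x := by
      have : (u : E →L[ℂ] E) x = y := DFunLike.congr_fun u.mul_inv y
      rw [← this, hu, sub_apply, Algebra.algebraMap_eq_smul_one, smul_apply, one_apply_eq_self]
    have h1 : A x - z • x = (w - z) • x - y := by rw [hy, sub_smul]; abel
    have h2 := h x
    rw [h1] at h2
    have h3 := norm_sub_le ((w - z) • x) y
    rw [norm_smul] at h3
    have h4 : ‖w - z‖ ≤ ε / 3 := by rw [← dist_eq_norm, dist_comm]; exact hzw.le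
    have h5 : ‖w - z‖ * ‖x‖ ≤ ε / 3 * ‖x‖ := by gcongr
    rw [div_mul_eq_mul_div, le_div_iff₀ hε]
    nlinarith [norm_nonneg x]
  rw [spectrum.mem_iff] at hz1
  refine hz1 ?_
  have hpos : 0 < ‖((u⁻¹ : (E →L[ℂ] E)ˣ) : E →L[ℂ] E)‖ ∨
      ‖((u⁻¹ : (E →L[ℂ] E)ˣ) : E →L[ℂ] E)‖ = 0 := (norm_nonneg _).lt_or_eq.imp id Eq.symm
  rcases hpos with hpos | h0
  · have : Nontrivial (E →L[ℂ] E) := ⟨_, 0, norm_pos_iff.1 hpos⟩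
    refine ⟨u.ofNearby (algebraMap ℂ (E →L[ℂ] E) z - A) ?_, rfl⟩
    rw [hu, sub_sub_sub_cancel_right, ← map_sub, norm_algebraMap]
    have h1 : ‖z - w‖ < ε / 3 := by rwa [← dist_eq_norm]
    have h2 : ε / 2 ≤ ‖((u⁻¹ : (E →L[ℂ] E)ˣ) : E →L[ℂ] E)‖⁻¹ := by
      rw [le_inv_comm₀ (by positivity) hpos, inv_div]
      exact hbound
    have h3 : ‖(1 : E →L[ℂ] E)‖ ≤ 1 := ContinuousLinearMap.norm_id_le
    nlinarith [norm_nonneg (z - w), norm_nonneg (1 : E →L[ℂ] E)]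
  -- An inverse of norm zero occurs only when 0 = 1 among the operators, and then everything is a
  -- unit.
  · have : Subsingleton (E →L[ℂ] E) := by
      have h1 : ((u⁻¹ : (E →L[ℂ] E)ˣ) : E →L[ℂ] E) = 0 := norm_eq_zero.1 h0
      refine subsingleton_of_zero_eq_one ?_
      rw [← u.inv_mul, h1, zero_mul]
    exact isUnit_of_subsingleton _

end ApproximatePointSpectrum

/-! ### Spectra of adjoints -/

section Hilbert

variable {E : Type*} [NormedAddCommGroup E] [InnerProductSpace ℂ E] [CompleteSpace E]

theorem mem_spectrum_adjoint_iff {A : E →L[ℂ] E} {z : ℂ} :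
    conj z ∈ spectrum ℂ A.adjoint ↔ z ∈ spectrum ℂ A := by
  rw [← ContinuousLinearMap.star_eq_adjoint, spectrum.map_star]
  simp

theorem frontier_spectrum_adjoint {A : E →L[ℂ] E} {z : ℂ} (hz : z ∈ frontier (spectrum ℂ A)) :
    conj z ∈ frontier (spectrum ℂ A.adjoint) := by
  have h : spectrum ℂ A = Complex.conjLIE.toHomeomorph ⁻¹' spectrum ℂ A.adjoint := by
    ext w
    exact mem_spectrum_adjoint_iff.symm
  rw [h, ← Homeomorph.preimage_frontier] at hz
  exact hz

theorem mem_approxPointSpectrum_or {A : E →L[ℂ] E} {z : ℂ} (hz : z ∈ spectrum ℂ A) :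
    z ∈ approxPointSpectrum A ∨ conj z ∈ approxPointSpectrum A.adjoint := by
  by_contra! hn
  obtain ⟨ε, hε, h⟩ := exists_bounded_below_of_notMem hn.1
  obtain ⟨δ, hδ, h'⟩ := exists_bounded_below_of_notMem hn.2
  rw [spectrum.mem_iff] at hz
  refine hz (isUnit_of_bounded_below (lt_min hε hδ) (fun x => ?_) fun x => ?_)
  · refine (mul_le_mul_of_nonneg_right (min_le_left _ _) (norm_nonneg x)).trans ((h x).trans ?_)
    rw [sub_apply, Algebra.algebraMap_eq_smul_one, smul_apply, one_apply_eq_self, norm_sub_rev]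
  · refine (mul_le_mul_of_nonneg_right (min_le_right _ _) (norm_nonneg x)).trans ((h' x).trans ?_)
    rw [map_sub, Algebra.algebraMap_eq_smul_one, map_smulₛₗ, sub_apply, smul_apply,
      ← ContinuousLinearMap.star_eq_adjoint 1, star_one, one_apply_eq_self, norm_sub_rev]

end Hilbert

/-! ### Operators on Hilbert tensor powers -/

section TensorOperators

variable {H : Type u} [NormedAddCommGroup H] [InnerProductSpace ℂ H] {n : ℕ}

namespace AlgTensorPower

/-- The linear map `v₁ ⊗ ⋯ ⊗ vₙ ↦ S₁ v₁ ⊗ ⋯ ⊗ Sₙ vₙ`. -/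
def mapFamilyₗ (S : Fin n → H →L[ℂ] H) : AlgTensorPower H n →ₗ[ℂ] AlgTensorPower H n :=
  lift (tmul.compLinearMap fun i => (S i : H →ₗ[ℂ] H))

@[simp] theorem mapFamilyₗ_tmul (S : Fin n → H →L[ℂ] H) (v : Fin n → H) :
    mapFamilyₗ S (tmul v) = tmul fun i => S i (v i) := by
  simp [mapFamilyₗ]

/-- In each slot the Gram kernel of `S k` is dominated by ‖S k‖² times that of the vectors. By the
Schur product argument of `posSemidef_prod` the domination survives multiplication over the slots,
and evaluating it on the coefficients of a tensor gives the norm bound. -/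
theorem norm_mapFamilyₗ_le (S : Fin n → H →L[ℂ] H) (x : AlgTensorPower H n) :
    ‖mapFamilyₗ S x‖ ≤ (∏ i, ‖S i‖) * ‖x‖ := by
  have hsq : ‖mapFamilyₗ S x‖ ^ 2 ≤ ((∏ i, ‖S i‖) * ‖x‖) ^ 2 := by
    rw [mul_pow, InnerProductSpace.norm_sq_eq_re_inner (𝕜 := ℂ) x,
      InnerProductSpace.norm_sq_eq_re_inner (𝕜 := ℂ) (mapFamilyₗ S x)]
    change RCLike.re (conj (conjForm (mapFamilyₗ S x) (mapFamilyₗ S x)))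
      ≤ (∏ i, ‖S i‖) ^ 2 * RCLike.re (conj (conjForm x x))
    obtain ⟨c, rfl⟩ := exists_finsupp x
    have hmap : mapFamilyₗ S (c.sum fun v a => a • tmul v)
        = c.sum fun v a => a • tmul (fun i => S i (v i)) := by
      simp [Finsupp.sum, map_sum]
    rw [hmap, conj_conjForm_sum c c (fun v i => S i (v i)) (fun v i => S i (v i)),
      conj_conjForm_sum c c (fun v => v) (fun v => v)]
    have h := (posSemidef_prod (κ := Fin n) Finset.univ
      (fun k (v w : Fin n → H) => inner ℂ (S k (v k)) (S k (w k)))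
      (fun k v w => (‖S k‖ : ℂ) ^ 2 * inner ℂ (v k) (w k))
      (fun k => posSemidef_gram fun v : Fin n → H => S k (v k))
      (fun k => posSemidef_sub_gram (fun v : Fin n → H => v k) (S k) ‖S k‖
        (S k).le_opNorm)).2
    have h2 := (Complex.nonneg_iff.1 (h.2 c)).1
    have h3 : (c.sum fun v a => c.sum fun w b => star a *
        (Matrix.of fun a b : Fin n → H => ∏ k, (‖S k‖ : ℂ) ^ 2 * inner ℂ (a k) (b k)
          - ∏ k, inner ℂ (S k (a k)) (S k (b k))) v w * b)
        = (((∏ k, ‖S k‖) ^ 2 : ℝ) : ℂ) * (c.sum fun v a => c.sum fun w b =>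
            star a * (∏ i, inner ℂ (v i) (w i)) * b)
          - c.sum fun v a => c.sum fun w b =>
            star a * (∏ i, inner ℂ (S i (v i)) (S i (w i))) * b := by
      simp only [Finsupp.sum, Finset.mul_sum, ← Finset.sum_sub_distrib, Matrix.of_apply,
        Finset.prod_mul_distrib, Finset.prod_pow]
      refine Finset.sum_congr rfl fun i _ => Finset.sum_congr rfl fun j _ => ?_
      push_cast
      ring
    rw [h3, Complex.sub_re, Complex.re_ofReal_mul] at h2
    exact sub_nonneg.1 h2
  exact (pow_le_pow_iff_left₀ (norm_nonneg _)
    (mul_nonneg (Finset.prod_nonneg fun _ _ => norm_nonneg _) (norm_nonneg _)) two_ne_zero).1 hsq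

/-- The linear map `v₁ ⊗ ⋯ ⊗ vₙ ↦ v_{σ(1)} ⊗ ⋯ ⊗ v_{σ(n)}`. -/
def permₗ (σ : Equiv.Perm (Fin n)) : AlgTensorPower H n →ₗ[ℂ] AlgTensorPower H n :=
  lift (tmul.domDomCongr σ)

@[simp] theorem permₗ_tmul (σ : Equiv.Perm (Fin n)) (v : Fin n → H) :
    permₗ σ (tmul v) = tmul fun i => v (σ i) := by
  simp only [permₗ, lift_tmul]
  rfl

theorem norm_permₗ (σ : Equiv.Perm (Fin n)) (x : AlgTensorPower H n) :
    ‖permₗ σ x‖ = ‖x‖ := by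
  have hsq : ‖permₗ σ x‖ ^ 2 = ‖x‖ ^ 2 := by
    rw [InnerProductSpace.norm_sq_eq_re_inner (𝕜 := ℂ) x,
      InnerProductSpace.norm_sq_eq_re_inner (𝕜 := ℂ) (permₗ σ x)]
    change RCLike.re (conj (conjForm (permₗ σ x) (permₗ σ x)))
      = RCLike.re (conj (conjForm x x))
    obtain ⟨c, rfl⟩ := exists_finsupp x
    have hmap : permₗ σ (c.sum fun v a => a • tmul v)
        = c.sum fun v a => a • tmul (fun i => v (σ i)) := by
      simp [Finsupp.sum, map_sum]
    rw [hmap, conj_conjForm_sum c c (fun v i => v (σ i)) (fun v i => v (σ i)),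
      conj_conjForm_sum c c (fun v => v) (fun v => v)]
    congr 1
    refine Finsupp.sum_congr fun v _ => Finsupp.sum_congr fun w _ => ?_
    rw [Equiv.prod_comp σ (fun i => inner ℂ (v i) (w i))]
  exact (pow_left_inj₀ (norm_nonneg _) (norm_nonneg _) two_ne_zero).1 hsq

end AlgTensorPower

/-- Elementary tensors as a multilinear map. -/
def elemTensorₘ : MultilinearMap ℂ (fun _ : Fin n => H) (TensorPower H n) :=
  (UniformSpace.Completion.toComplL (𝕜 := ℂ) (E := AlgTensorPower H n)).toLinearMap.compMultilinearMap
    AlgTensorPower.tmul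

theorem elemTensorₘ_apply (v : Fin n → H) : elemTensorₘ v = elemTensor v := rfl

theorem norm_elemTensor (v : Fin n → H) : ‖elemTensor v‖ = ∏ i, ‖v i‖ := by
  have h : ((‖elemTensor v‖ ^ 2 : ℝ) : ℂ) = (((∏ i, ‖v i‖) ^ 2 : ℝ) : ℂ) := by
    have h1 := inner_self_eq_norm_sq_to_K (𝕜 := ℂ) (elemTensor v)
    rw [inner_elemTensor] at h1
    push_cast
    refine h1.symm.trans ?_
    rw [← Finset.prod_pow]
    exact Finset.prod_congr rfl fun i _ => inner_self_eq_norm_sq_to_K (𝕜 := ℂ) (v i)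
  exact (pow_left_inj₀ (norm_nonneg _) (Finset.prod_nonneg fun _ _ => norm_nonneg _)
    two_ne_zero).1 (Complex.ofReal_injective h)

/-- Closed subspaces containing all elementary tensors are everything. -/
theorem mem_of_elemTensor_mem {p : Submodule ℂ (TensorPower H n)}
    (hp : IsClosed (p : Set (TensorPower H n))) (h : ∀ v, elemTensor v ∈ p) (x) : x ∈ p := by
  induction x using UniformSpace.Completion.induction_on with
  | hp => exact hp
  | ih x =>
    obtain ⟨c, rfl⟩ := AlgTensorPower.exists_finsupp x
    have h1 : ((c.sum fun v a => a • AlgTensorPower.tmul v : AlgTensorPower H n) :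
        TensorPower H n) = c.sum fun v a => a • elemTensor v := by
      simp only [Finsupp.sum, elemTensor]
      exact (map_sum (UniformSpace.Completion.toComplL (𝕜 := ℂ) (E := AlgTensorPower H n)) _ _).trans
        (Finset.sum_congr rfl fun v _ => map_smul _ _ _)
    rw [h1]
    exact Submodule.sum_mem _ fun v _ => Submodule.smul_mem _ _ (h v)

theorem clm_ext {E : Type*} [NormedAddCommGroup E] [NormedSpace ℂ E]
    {A B : TensorPower H n →L[ℂ] E} (h : ∀ v, A (elemTensor v) = B (elemTensor v)) : A = B := by
  ext x
  exact mem_of_elemTensor_mem (p := LinearMap.eqLocus (A : TensorPower H n →ₗ[ℂ] E) B)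
    (isClosed_eq A.continuous B.continuous) h x

/-- The operator `S₁ ⊗ ⋯ ⊗ Sₙ` on `H^{⊗n}`. -/
def tensorMap (S : Fin n → H →L[ℂ] H) : TensorPower H n →L[ℂ] TensorPower H n :=
  ((AlgTensorPower.mapFamilyₗ S).mkContinuous (∏ i, ‖S i‖)
    (AlgTensorPower.norm_mapFamilyₗ_le S)).completion

theorem tensorMap_elemTensor (S : Fin n → H →L[ℂ] H) (v : Fin n → H) :
    tensorMap S (elemTensor v) = elemTensor fun i => S i (v i) := by
  rw [elemTensor, tensorMap, ContinuousLinearMap.completion_apply_coe]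
  exact congrArg _ (AlgTensorPower.mapFamilyₗ_tmul S v)

/-- The operator on `H^{⊗n}` permuting the tensor factors. -/
def permMap (σ : Equiv.Perm (Fin n)) : TensorPower H n →L[ℂ] TensorPower H n :=
  ((AlgTensorPower.permₗ σ).mkContinuous 1 fun x => by
    rw [one_mul, AlgTensorPower.norm_permₗ]).completion

theorem permMap_elemTensor (σ : Equiv.Perm (Fin n)) (v : Fin n → H) :
    permMap σ (elemTensor v) = elemTensor fun i => v (σ i) := by
  rw [elemTensor, permMap, ContinuousLinearMap.completion_apply_coe]
  exact congrArg _ (AlgTensorPower.permₗ_tmul σ v)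

theorem tensorMap_mul (S S' : Fin n → H →L[ℂ] H) :
    tensorMap (S * S') = tensorMap S * tensorMap S' :=
  clm_ext fun v => by simp [tensorMap_elemTensor]

theorem tensorMap_one : tensorMap (1 : Fin n → H →L[ℂ] H) = 1 :=
  clm_ext fun v => by simp [tensorMap_elemTensor]

/-- Families of operators on `H` act multiplicatively on `H^{⊗n}`. -/
def tensorMapHom : (Fin n → H →L[ℂ] H) →* (TensorPower H n →L[ℂ] TensorPower H n) where
  toFun := tensorMap
  map_one' := tensorMap_one
  map_mul' := tensorMap_mul

theorem tensorMapHom_const (T : H →L[ℂ] H) :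
    tensorMapHom (fun _ : Fin n => T) = tensorPowerMap T n :=
  clm_ext fun v => by
    rw [tensorPowerMap_elemTensor]
    exact tensorMap_elemTensor _ v

/-- The operator `1 ⊗ ⋯ ⊗ T ⊗ ⋯ ⊗ 1` with `T` acting on the `j`-th factor. -/
def slotMap (j : Fin n) (T : H →L[ℂ] H) : TensorPower H n →L[ℂ] TensorPower H n :=
  tensorMapHom (Pi.mulSingle j T)

/-- Elementary tensors are linear in the j-th slot. Together with multiplicativity this makes
invertibility of `z - T` pass to its slot operator. -/
theorem slotMap_sub_algebraMap (j : Fin n) (T : H →L[ℂ] H) (z : ℂ) :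
    algebraMap ℂ _ z - slotMap j T = slotMap j (algebraMap ℂ _ z - T) := by
  refine clm_ext fun v => ?_
  have key : ∀ S : H →L[ℂ] H, slotMap j S (elemTensor v)
      = elemTensorₘ (Function.update v j (S (v j))) := fun S => by
    refine (tensorMap_elemTensor _ v).trans ?_
    rw [elemTensorₘ_apply]
    congr 1
    ext i
    rcases eq_or_ne i j with rfl | h
    · simp
    · simp [h]
  rw [key, sub_apply, sub_apply, key,
    MultilinearMap.map_update_sub, Algebra.algebraMap_eq_smul_one, Algebra.algebraMap_eq_smul_one,
    smul_apply, smul_apply, one_apply_eq_self, one_apply_eq_self, MultilinearMap.map_update_smul,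
    Function.update_eq_self, elemTensorₘ_apply, elemTensorₘ_apply]

theorem spectrum_slotMap_subset (j : Fin n) (T : H →L[ℂ] H) :
    spectrum ℂ (slotMap j T) ⊆ spectrum ℂ T := by
  intro z hz
  rw [spectrum.mem_iff] at hz ⊢
  refine fun h => hz ?_
  rw [slotMap_sub_algebraMap]
  exact (h.map (MonoidHom.mulSingle (fun _ : Fin n => H →L[ℂ] H) j)).map tensorMapHom

theorem slotMap_commute (T : H →L[ℂ] H) (i j : Fin n) :
    Commute (slotMap i T) (slotMap j T) := by
  rcases eq_or_ne i j with rfl | h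
  · exact Commute.refl _
  · exact Commute.map (Pi.mulSingle_commute (f := fun _ : Fin n => H →L[ℂ] H) h T T) tensorMapHom

theorem noncommProd_slotMap (T : H →L[ℂ] H) :
    (Finset.univ.noncommProd (fun j : Fin n => slotMap j T)
      fun i _ j _ _ => slotMap_commute T i j) = tensorPowerMap T n := by
  rw [← tensorMapHom_const]
  refine (Finset.map_noncommProd Finset.univ
    (fun j : Fin n => (Pi.mulSingle j T : Fin n → H →L[ℂ] H))
    (fun i _ j _ h => Pi.mulSingle_commute (f := fun _ : Fin n => H →L[ℂ] H) h T T)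
    tensorMapHom).symm.trans (congrArg tensorMapHom ?_)
  exact Finset.noncommProd_mulSingle (M := fun _ : Fin n => H →L[ℂ] H) (fun _ : Fin n => T)

end TensorOperators

/-! ### Symmetric tensors and approximate eigenvectors -/

section Symmetric

variable {H : Type u} [NormedAddCommGroup H] [InnerProductSpace ℂ H] {n : ℕ}

theorem isClosed_symTensorPower : IsClosed (symTensorPower H n : Set (TensorPower H n)) :=
  Submodule.isClosed_topologicalClosure _

instance : CompleteSpace (symTensorPower H n) :=
  isClosed_symTensorPower.completeSpace_coe

theorem symTensor_mem (v : Fin n → H) : symTensor v ∈ symTensorPower H n :=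
  Submodule.le_topologicalClosure _ (Submodule.subset_span ⟨v, rfl⟩)

theorem permMap_symTensor (τ : Equiv.Perm (Fin n)) (v : Fin n → H) :
    permMap τ (symTensor v) = symTensor v := by
  simp only [symTensor, map_sum, permMap_elemTensor]
  exact Equiv.sum_comp (Equiv.mulRight τ) fun σ : Equiv.Perm (Fin n) => elemTensor fun i => v (σ i)

theorem permMap_of_mem (τ : Equiv.Perm (Fin n)) {x : TensorPower H n}
    (hx : x ∈ symTensorPower H n) : permMap τ x = x := by
  have h : symTensorPower H n ≤ LinearMap.eqLocus
      (permMap (H := H) τ : TensorPower H n →ₗ[ℂ] TensorPower H n) LinearMap.id := by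
    refine Submodule.topologicalClosure_minimal _ (Submodule.span_le.2 ?_)
      (isClosed_eq (permMap (H := H) τ).continuous continuous_id)
    rintro _ ⟨v, rfl⟩
    exact permMap_symTensor τ v
  exact h hx

/-- The projection of `H^{⊗n}` onto the symmetric tensors. -/
def symmetrizer (H : Type u) [NormedAddCommGroup H] [InnerProductSpace ℂ H] (n : ℕ) :
    TensorPower H n →L[ℂ] TensorPower H n :=
  (n.factorial : ℂ)⁻¹ • ∑ σ : Equiv.Perm (Fin n), permMap σ

theorem symmetrizer_apply (x : TensorPower H n) :
    symmetrizer H n x = (n.factorial : ℂ)⁻¹ • ∑ σ : Equiv.Perm (Fin n), permMap σ x := by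
  simp [symmetrizer]

theorem symmetrizer_of_mem {x : TensorPower H n} (hx : x ∈ symTensorPower H n) :
    symmetrizer H n x = x := by
  rw [symmetrizer_apply, Finset.sum_congr rfl fun σ _ => permMap_of_mem σ hx, Finset.sum_const,
    Finset.card_univ, Fintype.card_perm, Fintype.card_fin, ← Nat.cast_smul_eq_nsmul ℂ, smul_smul,
    inv_mul_cancel₀ (Nat.cast_ne_zero.2 n.factorial_ne_zero), one_smul]

theorem symmetrizer_mem (x : TensorPower H n) : symmetrizer H n x ∈ symTensorPower H n := by
  refine mem_of_elemTensor_mem (p := (symTensorPower H n).comap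
    (symmetrizer H n : TensorPower H n →ₗ[ℂ] TensorPower H n))
    (isClosed_symTensorPower.preimage (symmetrizer H n).continuous) (fun v => ?_) x
  change symmetrizer H n (elemTensor v) ∈ symTensorPower H n
  simp only [symmetrizer_apply, permMap_elemTensor]
  exact Submodule.smul_mem _ _ (symTensor_mem v)

theorem permMap_tensorPowerMap (T : H →L[ℂ] H) (σ : Equiv.Perm (Fin n)) (x : TensorPower H n) :
    permMap σ (tensorPowerMap T n x) = tensorPowerMap T n (permMap σ x) := by
  have h : (permMap σ).comp (tensorPowerMap T n) = (tensorPowerMap T n).comp (permMap σ) :=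
    clm_ext fun v => by simp [permMap_elemTensor, tensorPowerMap_elemTensor]
  exact DFunLike.congr_fun h x

theorem symmetrizer_tensorPowerMap (T : H →L[ℂ] H) (x : TensorPower H n) :
    symmetrizer H n (tensorPowerMap T n x) = tensorPowerMap T n (symmetrizer H n x) := by
  simp only [symmetrizer_apply, permMap_tensorPowerMap, map_smul, map_sum]

/-- Restriction to an invariant subspace can enlarge the spectrum, since surjectivity may be lost.
Here symmetrizing a preimage of a symmetric tensor yields a symmetric preimage, because the
symmetrizer commutes with `tensorPowerMap T n`. -/
theorem spectrum_symTensorPowerMap_subset (T : H →L[ℂ] H) (n : ℕ) :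
    spectrum ℂ (symTensorPowerMap T n) ⊆ spectrum ℂ (tensorPowerMap T n) := by
  intro z
  rw [spectrum.mem_iff, spectrum.mem_iff, not_imp_not, ContinuousLinearMap.isUnit_iff_bijective,
    ContinuousLinearMap.isUnit_iff_bijective]
  have happ : ∀ x : symTensorPower H n,
      (((algebraMap ℂ (symTensorPower H n →L[ℂ] symTensorPower H n) z
        - symTensorPowerMap T n) x : symTensorPower H n) : TensorPower H n)
      = (algebraMap ℂ (TensorPower H n →L[ℂ] TensorPower H n) z - tensorPowerMap T n) x := by
    intro x
    simp only [sub_apply, Algebra.algebraMap_eq_smul_one, smul_apply, one_apply_eq_self]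
    rfl
  rintro ⟨hinj, hsurj⟩
  refine ⟨fun x y hxy => Subtype.ext (hinj ?_), fun y => ?_⟩
  · rw [← happ, ← happ, hxy]
  · obtain ⟨x, hx⟩ := hsurj y
    refine ⟨⟨symmetrizer H n x, symmetrizer_mem x⟩, Subtype.ext ?_⟩
    rw [happ, ← symmetrizer_of_mem y.2, ← hx]
    simp only [sub_apply, Algebra.algebraMap_eq_smul_one, smul_apply, one_apply_eq_self, map_sub,
      map_smul, symmetrizer_tensorPowerMap]

theorem exists_prod_of_mem_spectrum_tensorPowerMap (T : H →L[ℂ] H) {z : ℂ}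
    (hz : z ∈ spectrum ℂ (tensorPowerMap T n)) :
    ∃ l : Fin n → ℂ, (∀ j, l j ∈ spectrum ℂ T) ∧ z = ∏ j, l j := by
  rw [← noncommProd_slotMap] at hz
  obtain ⟨l, hl, h⟩ := exists_prod_of_mem_spectrum_noncommProd _
    (fun i j => slotMap_commute T i j) hz
  exact ⟨l, fun j => spectrum_slotMap_subset j T (hl j), h⟩

/-- Finitely many unit vectors are simultaneously far from orthogonal to some bounded vector. -/
theorem exists_le_norm_inner : ∀ (n : ℕ) (x : Fin n → H), (∀ i, ‖x i‖ = 1) →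
    ∃ u : H, ‖u‖ ≤ n ∧ ∀ i, (1 / 4 : ℝ) ^ n ≤ ‖inner ℂ u (x i)‖
  | 0, _, _ => ⟨0, by simp, fun i => i.elim0⟩
  | n + 1, x, hx => by
    obtain ⟨u, hu, hux⟩ := exists_le_norm_inner n (fun i => x i.castSucc) fun i => hx _
    set c : ℝ := (1 / 4 : ℝ) ^ n with hc
    have hc0 : 0 < c := by positivity
    have hc1 : c ≤ 1 := pow_le_one₀ (by norm_num) (by norm_num)
    rw [pow_succ, ← hc]
    by_cases h : c / 4 ≤ ‖inner ℂ u (x (Fin.last n))‖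
    · refine ⟨u, hu.trans (by push_cast; linarith), fun i => ?_⟩
      induction i using Fin.lastCases with
      | last => linarith
      | cast i => linarith [hux i]
    -- Adding (c / 2) w raises the pairing with w, so far below c / 4 in modulus, to at least c / 4.
    -- The other pairings, at least c, lose at most c / 2.
    · set w := x (Fin.last n) with hw
      have hw1 : ‖w‖ = 1 := hx _
      have hinner : ∀ y, inner ℂ (u + ((c / 2 : ℝ) : ℂ) • w) y
          = inner ℂ u y + ((c / 2 : ℝ) : ℂ) * inner ℂ w y := fun y => by
        rw [inner_add_left, inner_smul_left, Complex.conj_ofReal]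
      have habs : ‖((c / 2 : ℝ) : ℂ)‖ = c / 2 := by
        rw [Complex.norm_real, Real.norm_of_nonneg (by positivity)]
      refine ⟨u + ((c / 2 : ℝ) : ℂ) • w, ?_, fun i => ?_⟩
      · refine (norm_add_le _ _).trans ?_
        rw [norm_smul, habs, hw1]
        push_cast
        linarith
      · rw [hinner]
        induction i using Fin.lastCases with
        | last =>
          rw [← hw, inner_self_eq_norm_sq_to_K, hw1]
          have h1 := norm_sub_le (inner ℂ u w + ((c / 2 : ℝ) : ℂ)) (inner ℂ u w)
          rw [add_sub_cancel_left, habs] at h1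
          simp only [RCLike.ofReal_one, one_pow, mul_one]
          linarith [not_le.1 h]
        | cast i =>
          have h1 := norm_sub_le (inner ℂ u (x i.castSucc)
            + ((c / 2 : ℝ) : ℂ) * inner ℂ w (x i.castSucc))
            (((c / 2 : ℝ) : ℂ) * inner ℂ w (x i.castSucc))
          rw [add_sub_cancel_right, norm_mul, habs] at h1
          have h2 := norm_inner_le_norm (𝕜 := ℂ) w (x i.castSucc)
          rw [hw1, hx, one_mul] at h2
          nlinarith [hux i]

/-- Pairing with `u ⊗ ⋯ ⊗ u` does not see the order of the factors, so the n! terms add up without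
cancellation. With u from `exists_le_norm_inner`, Cauchy–Schwarz gives a bound uniform in the unit
vectors. -/
theorem exists_pos_le_norm_symTensor (H : Type u) [NormedAddCommGroup H] [InnerProductSpace ℂ H]
    (n : ℕ) : ∃ c > 0, ∀ x : Fin n → H, (∀ i, ‖x i‖ = 1) → c ≤ ‖symTensor x‖ := by
  refine ⟨((1 / 4 : ℝ) ^ n) ^ n / (n + 1) ^ n, by positivity, fun x hx => ?_⟩
  obtain ⟨u, hu, hux⟩ := exists_le_norm_inner n x hx
  have h1 : inner ℂ (elemTensor fun _ : Fin n => u) (symTensor x)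
      = n.factorial * ∏ i, inner ℂ u (x i) := by
    simp only [symTensor, inner_sum, inner_elemTensor]
    rw [Finset.sum_congr rfl fun σ _ => Equiv.prod_comp σ fun i => inner ℂ u (x i)]
    simp [Fintype.card_perm]
  have h2 := norm_inner_le_norm (𝕜 := ℂ) (elemTensor fun _ : Fin n => u) (symTensor x)
  rw [h1, norm_elemTensor, norm_mul, norm_prod, Complex.norm_natCast, Finset.prod_const,
    Finset.card_univ, Fintype.card_fin] at h2
  have h3 : ((1 / 4 : ℝ) ^ n) ^ n ≤ ∏ i, ‖inner ℂ u (x i)‖ := by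
    simpa using Finset.prod_le_prod (s := Finset.univ)
      (f := fun _ : Fin n => (1 / 4 : ℝ) ^ n) (fun _ _ => by positivity) fun i _ => hux i
  have h4 : (1 : ℝ) ≤ n.factorial := by exact_mod_cast n.factorial_pos
  have h5 : ‖u‖ ^ n ≤ ((n : ℝ) + 1) ^ n := by gcongr; linarith
  rw [div_le_iff₀ (by positivity)]
  calc ((1 / 4 : ℝ) ^ n) ^ n ≤ 1 * ∏ i, ‖inner ℂ u (x i)‖ := by rwa [one_mul]
    _ ≤ n.factorial * ∏ i, ‖inner ℂ u (x i)‖ := by gcongr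
    _ ≤ ‖u‖ ^ n * ‖symTensor x‖ := h2
    _ ≤ ((n : ℝ) + 1) ^ n * ‖symTensor x‖ := by gcongr
    _ = _ := mul_comm _ _

/-- The symmetrized product of unit approximate eigenvectors is an approximate eigenvector: each
permuted term has an error linear in ε by the Lipschitz estimate for multilinear maps, and the norm
of the sum stays away from 0. -/
theorem prod_mem_spectrum_of_mem_approxPointSpectrum (T : H →L[ℂ] H) (l : Fin n → ℂ)
    (hl : ∀ i, l i ∈ approxPointSpectrum T) :
    ∏ i, l i ∈ spectrum ℂ (symTensorPowerMap T n) := by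
  obtain ⟨c, hc, hcx⟩ := exists_pos_le_norm_symTensor H n
  set M : ℝ := ‖T‖ + ∑ i, ‖l i‖ with hM
  have hl0 : ∀ i, ‖l i‖ ≤ ∑ i, ‖l i‖ := fun i =>
    Finset.single_le_sum (f := fun i => ‖l i‖) (fun _ _ => norm_nonneg _) (Finset.mem_univ i)
  have hM0 : 0 ≤ M := add_nonneg (norm_nonneg _) (Finset.sum_nonneg fun _ _ => norm_nonneg _)
  refine mem_spectrum_of_approx (C := n.factorial * (n * M ^ (n - 1))) hc fun ε hε => ?_
  choose x hx1 hx using fun i => hl i ε hε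
  refine ⟨⟨symTensor x, symTensor_mem x⟩, hcx x hx1, ?_⟩
  change ‖tensorPowerMap T n (symTensor x) - (∏ i, l i) • symTensor x‖ ≤ _
  have hterm : ∀ σ : Equiv.Perm (Fin n),
      ‖elemTensor (fun i => T (x (σ i))) - (∏ i, l i) • elemTensor fun i => x (σ i)‖
        ≤ n * M ^ (n - 1) * ε := by
    intro σ
    have h1 : (∏ i, l i) • elemTensor (fun i => x (σ i))
        = elemTensorₘ fun i => l (σ i) • x (σ i) := by
      rw [MultilinearMap.map_smul_univ, Equiv.prod_comp σ l, elemTensorₘ_apply]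
    rw [h1, ← elemTensorₘ_apply]
    refine (MultilinearMap.norm_image_sub_le_of_bound (𝕜 := ℂ) (E := fun _ : Fin n => H)
      (G := TensorPower H n) elemTensorₘ zero_le_one (fun m => ?_) _ _).trans ?_
    · rw [elemTensorₘ_apply, norm_elemTensor, one_mul]
    rw [one_mul, Fintype.card_fin]
    gcongr
    · refine max_le ?_ ?_
      · refine (pi_norm_le_iff_of_nonneg hM0).2 fun i => ?_
        have h2 := T.le_opNorm (x (σ i))
        rw [hx1, mul_one] at h2
        linarith [norm_nonneg (l (σ i)), hl0 (σ i)]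
      · refine (pi_norm_le_iff_of_nonneg hM0).2 fun i => ?_
        rw [norm_smul, hx1, mul_one]
        linarith [norm_nonneg T, hl0 (σ i)]
    · exact (pi_norm_le_iff_of_nonneg hε.le).2 fun i => (hx (σ i)).le
  rw [symTensor, map_sum, Finset.smul_sum, ← Finset.sum_sub_distrib]
  simp only [tensorPowerMap_elemTensor]
  refine (norm_sum_le _ _).trans ((Finset.sum_le_sum fun σ _ => hterm σ).trans ?_)
  rw [Finset.sum_const, Finset.card_univ, Fintype.card_perm, Fintype.card_fin, nsmul_eq_mul]
  exact (mul_assoc _ _ _).ge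

/-- As an identity of inner products, this restricts at once to symmetric tensors. -/
theorem inner_tensorPowerMap_adjoint [CompleteSpace H] (T : H →L[ℂ] H) (x y : TensorPower H n) :
    inner ℂ (tensorPowerMap T.adjoint n x) y = inner ℂ x (tensorPowerMap T n y) := by
  have h : tensorPowerMap T.adjoint n = (tensorPowerMap T n).adjoint := by
    refine clm_ext fun v => ext_inner_right ℂ fun w => ?_
    have h1 : innerSL ℂ (tensorPowerMap T.adjoint n (elemTensor v))
        = innerSL ℂ ((tensorPowerMap T n).adjoint (elemTensor v)) := by
      refine clm_ext fun w => ?_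
      simp only [innerSL_apply_apply, ContinuousLinearMap.adjoint_inner_left,
        tensorPowerMap_elemTensor, inner_elemTensor]
    exact DFunLike.congr_fun h1 w
  rw [h, ContinuousLinearMap.adjoint_inner_left]

theorem symTensorPowerMap_adjoint [CompleteSpace H] (T : H →L[ℂ] H) (n : ℕ) :
    symTensorPowerMap T.adjoint n = (symTensorPowerMap T n).adjoint :=
  (ContinuousLinearMap.eq_adjoint_iff _ _).2 fun x y =>
    inner_tensorPowerMap_adjoint T (x : TensorPower H n) (y : TensorPower H n)

end Symmetric

/-! ### Moving the factors of a product to the frontier -/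

open Filter Topology in
/-- In a compact set of complex numbers, the points of a tuple with nonzero product can be moved,
without changing the product, such that at most one of them is an interior point. -/
theorem exists_prod_eq_frontier {S : Set ℂ} (hS : IsCompact S) {n : ℕ} (l : Fin n → ℂ)
    (hl : ∀ i, l i ∈ S) (h0 : ∏ i, l i ≠ 0) :
    ∃ m : Fin n → ℂ, (∀ i, m i ∈ S) ∧ ∏ i, m i = ∏ i, l i ∧
      ∀ i j, i ≠ j → m i ∈ frontier S ∨ m j ∈ frontier S := by
  have hK : IsCompact (Set.pi Set.univ (fun _ : Fin n => S) ∩ {m | ∏ i, m i = ∏ i, l i}) :=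
    (isCompact_univ_pi fun _ => hS).inter_right
      (isClosed_eq (by fun_prop) continuous_const)
  -- Choose a tuple with this product that maximizes the sum of squared moduli. If two entries were
  -- interior, multiplying the larger by some t > 1 and the smaller by 1 / t would keep the product
  -- and increase the sum.
  obtain ⟨m, ⟨hmS, hml⟩, hmax⟩ := hK.exists_isMaxOn ⟨l, fun i _ => hl i, rfl⟩
    (f := fun m : Fin n → ℂ => ∑ i, ‖m i‖ ^ 2) (by fun_prop)
  refine ⟨m, fun i => hmS i trivial, hml, ?_⟩
  have hm0 : ∀ i, m i ≠ 0 := fun i => Finset.prod_ne_zero_iff.1 (hml.trans_ne h0) i (Finset.mem_univ i)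
  have hint : ∀ i, m i ∉ frontier S → S ∈ 𝓝 (m i) := fun i hi => by
    rw [mem_interior_iff_mem_nhds.symm]
    by_contra h
    exact hi ⟨subset_closure (hmS i trivial), h⟩
  have key : ∀ i j, i ≠ j → ‖m j‖ ≤ ‖m i‖ → m i ∈ frontier S ∨ m j ∈ frontier S := by
    intro i j hij hle
    by_contra! hn
    have h1 : Tendsto (fun t : ℝ => (t : ℂ) * m i) (𝓝 1) (𝓝 (m i)) := by
      have : Continuous fun t : ℝ => (t : ℂ) * m i := by fun_prop
      simpa using this.tendsto 1
    have h2 : Tendsto (fun t : ℝ => ((t⁻¹ : ℝ) : ℂ) * m j) (𝓝 1) (𝓝 (m j)) := by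
      have : ContinuousAt (fun t : ℝ => ((t⁻¹ : ℝ) : ℂ) * m j) 1 := by
        have h3 : ContinuousAt (fun t : ℝ => t⁻¹) 1 := continuousAt_inv₀ one_ne_zero
        exact (Complex.continuous_ofReal.continuousAt.comp h3).mul continuousAt_const
      simpa using this.tendsto
    obtain ⟨t, ⟨ht1, ht2⟩, ht⟩ := ((((h1.eventually (hint i hn.1)).and
      (h2.eventually (hint j hn.2))).filter_mono nhdsWithin_le_nhds).and
      (self_mem_nhdsWithin (s := Set.Ioi (1 : ℝ)))).exists
    replace ht : 1 < t := ht
    let c : Fin n → ℂ := fun k => if k = i then (t : ℂ) else if k = j then ((t⁻¹ : ℝ) : ℂ) else 1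
    have hci : c i = t := by simp [c]
    have hcj : c j = ((t⁻¹ : ℝ) : ℂ) := by simp [c, hij.symm]
    have hck : ∀ k, k ≠ i ∧ k ≠ j → c k = 1 := fun k hk => by simp [c, hk.1, hk.2]
    have hmem : (fun k => c k * m k) ∈
        Set.pi Set.univ (fun _ : Fin n => S) ∩ {m | ∏ i, m i = ∏ i, l i} := by
      refine ⟨fun k _ => ?_, ?_⟩
      · change c k * m k ∈ S
        by_cases hki : k = i
        · rw [hki, hci]
          exact ht1
        by_cases hkj : k = j
        · rw [hkj, hcj]
          exact ht2
        rw [hck k ⟨hki, hkj⟩, one_mul]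
        exact hmS k trivial
      · change ∏ k, c k * m k = _
        rw [Finset.prod_mul_distrib, Fintype.prod_eq_mul i j hij hck, hci, hcj, hml,
          ← Complex.ofReal_mul, mul_inv_cancel₀ (by positivity), Complex.ofReal_one, one_mul]
    have hle2 : ∑ k, ‖c k * m k‖ ^ 2 ≤ ∑ k, ‖m k‖ ^ 2 := hmax hmem
    rw [← sub_nonpos, ← Finset.sum_sub_distrib, Fintype.sum_eq_add i j hij (fun k hk => by
      rw [hck k hk, one_mul, sub_self]), hci, hcj, norm_mul, norm_mul, Complex.norm_real,
      Complex.norm_real, Real.norm_of_nonneg (by positivity), Real.norm_of_nonneg (by positivity),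
      mul_pow, mul_pow] at hle2
    have ha : 0 < ‖m i‖ ^ 2 := pow_pos (norm_pos_iff.2 (hm0 i)) 2
    have hab : ‖m j‖ ^ 2 ≤ ‖m i‖ ^ 2 := by gcongr
    have hs : t⁻¹ < 1 := inv_lt_one_of_one_lt₀ ht
    have hs0 : 0 < t⁻¹ := by positivity
    have hts : t * t⁻¹ = 1 := mul_inv_cancel₀ (by positivity)
    set s := t⁻¹
    have hsum : 0 < t ^ 2 + s ^ 2 - 2 := by nlinarith [sq_nonneg (t - s)]
    -- The change in the sum is at least ‖m i‖² (t² + s² - 2), which is positive as t s = 1 and t ≠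
    -- s.
    nlinarith [mul_le_mul_of_nonneg_right hab (show 0 ≤ 1 - s ^ 2 by nlinarith)]
  intro i j hij
  rcases le_total ‖m j‖ ‖m i‖ with h | h
  · exact key i j hij h
  · exact (key j i hij.symm h).symm

/-! ### Spectra of the tensor powers -/

section TensorSpectrum

variable {H : Type u} [NormedAddCommGroup H] [InnerProductSpace ℂ H] [CompleteSpace H]

/-- A product of points of the spectrum is a product of points of the approximate point spectrum, or
the conjugate of a product of points of that of the adjoint. -/
theorem exists_prod_eq_approxPointSpectrum (T : H →L[ℂ] H) {n : ℕ} (l : Fin n → ℂ)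
    (hl : ∀ i, l i ∈ spectrum ℂ T) :
    ∃ m : Fin n → ℂ, ∏ i, m i = ∏ i, l i ∧ ((∀ i, m i ∈ approxPointSpectrum T) ∨
      ∀ i, conj (m i) ∈ approxPointSpectrum T.adjoint) := by
  by_cases h0 : ∏ i, l i = 0
  · obtain ⟨j, -, hj⟩ := Finset.prod_eq_zero_iff.1 h0
    -- Some factor is 0, so 0 is in the spectrum and one alternative holds for it; repeating it in
    -- every slot keeps the product 0.
    refine ⟨fun _ => 0, ?_, ?_⟩
    · rw [h0]
      exact Finset.prod_eq_zero (Finset.mem_univ j) rfl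
    · have h := mem_approxPointSpectrum_or (hl j)
      rw [hj] at h
      exact h.imp (fun h _ => h) fun h _ => h
  · obtain ⟨m, hm, hml, hmf⟩ := exists_prod_eq_frontier (spectrum.isCompact T) l hl h0
    refine ⟨m, hml, ?_⟩
    have hL : ∀ i, m i ∈ frontier (spectrum ℂ T) → m i ∈ approxPointSpectrum T :=
      fun i hi => frontier_spectrum_subset_approxPointSpectrum T hi
    have hR : ∀ i, m i ∈ frontier (spectrum ℂ T) → conj (m i) ∈ approxPointSpectrum T.adjoint :=
      fun i hi => frontier_spectrum_subset_approxPointSpectrum _ (frontier_spectrum_adjoint hi)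
    by_cases hall : ∀ i, m i ∈ frontier (spectrum ℂ T)
    · exact Or.inl fun i => hL i (hall i)
    · push Not at hall
      obtain ⟨i, hi⟩ := hall
      have hf : ∀ j, j ≠ i → m j ∈ frontier (spectrum ℂ T) := fun j hj =>
        (hmf j i hj).resolve_right hi
      refine (mem_approxPointSpectrum_or (hm i)).imp (fun h j => ?_) fun h j => ?_
      · by_cases hj : j = i
        · rwa [hj]
        · exact hL j (hf j hj)
      · by_cases hj : j = i
        · rwa [hj]
        · exact hR j (hf j hj)

/-- When the approximate eigenvalues belong to the adjoint, apply the result to `T.adjoint` and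
conjugate back, using that symmetric powers commute with adjoints. -/
theorem prod_mem_spectrum_symTensorPowerMap (T : H →L[ℂ] H) {n : ℕ} (l : Fin n → ℂ)
    (hl : ∀ i, l i ∈ spectrum ℂ T) : ∏ i, l i ∈ spectrum ℂ (symTensorPowerMap T n) := by
  obtain ⟨m, hml, hm | hm⟩ := exists_prod_eq_approxPointSpectrum T l hl
  · rw [← hml]
    exact prod_mem_spectrum_of_mem_approxPointSpectrum T m hm
  · have h := prod_mem_spectrum_of_mem_approxPointSpectrum T.adjoint _ hm
    rwa [← map_prod, symTensorPowerMap_adjoint, mem_spectrum_adjoint_iff, hml] at h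

theorem spectrum_tensorPowerMap (T : H →L[ℂ] H) (n : ℕ) : spectrum ℂ (tensorPowerMap T n)
    = {z : ℂ | ∃ l : Fin n → ℂ, (∀ j, l j ∈ spectrum ℂ T) ∧ z = ∏ j, l j} := by
  refine Set.Subset.antisymm (fun z hz => exists_prod_of_mem_spectrum_tensorPowerMap T hz) ?_
  rintro _ ⟨l, hl, rfl⟩
  exact spectrum_symTensorPowerMap_subset T n (prod_mem_spectrum_symTensorPowerMap T l hl)

theorem spectrum_symTensorPowerMap (T : H →L[ℂ] H) (n : ℕ) : spectrum ℂ (symTensorPowerMap T n)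
    = {z : ℂ | ∃ l : Fin n → ℂ, (∀ j, l j ∈ spectrum ℂ T) ∧ z = ∏ j, l j} := by
  refine Set.Subset.antisymm ?_ ?_
  · rw [← spectrum_tensorPowerMap]
    exact spectrum_symTensorPowerMap_subset T n
  · rintro _ ⟨l, hl, rfl⟩
    exact prod_mem_spectrum_symTensorPowerMap T l hl

end TensorSpectrum

/-! ### Spectra of direct sums -/

section DirectSum

variable {E : ℕ → Type*} [∀ n, NormedAddCommGroup (E n)] [∀ n, NormedSpace ℂ (E n)]
  [∀ n, CompleteSpace (E n)]

theorem spectrum_subset_spectrum_mapCLM (A : ∀ n, E n →L[ℂ] E n) {K : ℝ} (hK : 0 ≤ K)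
    (h : ∀ n, ‖A n‖ ≤ K) (n : ℕ) :
    spectrum ℂ (A n) ⊆ spectrum ℂ (lp.mapCLM 2 A hK h) := by
  intro z
  rw [spectrum.mem_iff, spectrum.mem_iff, not_imp_not, ContinuousLinearMap.isUnit_iff_bijective,
    ContinuousLinearMap.isUnit_iff_bijective]
  have happ : ∀ (f : lp E 2) (k : ℕ),
      ((algebraMap ℂ (lp E 2 →L[ℂ] lp E 2) z - lp.mapCLM 2 A hK h) f : lp E 2) k
        = (algebraMap ℂ (E k →L[ℂ] E k) z - A k) (f k) := by
    intro f k
    simp only [sub_apply, Algebra.algebraMap_eq_smul_one, smul_apply, one_apply_eq_self,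
      lp.coeFn_sub, Pi.sub_apply, lp.mapCLM_apply_coe, lp.coeFn_smul, Pi.smul_apply]
  rintro ⟨hinj, hsurj⟩
  refine ⟨fun x y hxy => ?_, fun y => ?_⟩
  · have h1 : lp.single 2 n x = lp.single 2 n y := by
      refine hinj (lp.ext (funext fun k => ?_))
      rw [happ, happ]
      rcases eq_or_ne k n with rfl | hk
      · rw [lp.single_apply_self, lp.single_apply_self, hxy]
      · rw [lp.single_apply_ne _ _ _ hk, lp.single_apply_ne _ _ _ hk]
    rw [← lp.single_apply_self 2 n x, h1, lp.single_apply_self]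
  · obtain ⟨f, hf⟩ := hsurj (lp.single 2 n y)
    refine ⟨f n, ?_⟩
    rw [← happ, hf, lp.single_apply_self]

/-- Invertibility of every `z - A n` is not enough: the inverses must be uniformly bounded to form
an operator on the direct sum. Once ‖A n‖ ≤ ‖z‖ / 2 they are bounded by 2 / ‖z‖, which leaves
finitely many others. -/
theorem exists_mem_spectrum_of_mem_spectrum_mapCLM (A : ∀ n, E n →L[ℂ] E n) {K : ℝ} (hK : 0 ≤ K)
    (h : ∀ n, ‖A n‖ ≤ K) {r : ℝ} (hr0 : 0 ≤ r) (hr : r < 1) (hA : ∀ n, ‖A n‖ ≤ r ^ n) {z : ℂ}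
    (hz : z ∈ spectrum ℂ (lp.mapCLM 2 A hK h)) (hz0 : z ≠ 0) : ∃ n, z ∈ spectrum ℂ (A n) := by
  by_contra! hn
  simp only [spectrum.notMem_iff] at hn
  choose u hu using hn
  have hzpos : 0 < ‖z‖ := norm_pos_iff.2 hz0
  obtain ⟨N, hN⟩ := ((tendsto_pow_atTop_nhds_zero_of_lt_one hr0 hr).eventually
    (ge_mem_nhds (half_pos hzpos))).exists_forall_of_atTop
  let B : ∀ n, E n →L[ℂ] E n := fun n => ((u n)⁻¹ : (E n →L[ℂ] E n)ˣ)
  have huB : ∀ n x, (u n : E n →L[ℂ] E n) (B n x) = x := fun n x =>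
    DFunLike.congr_fun (u n).mul_inv x
  have hBu : ∀ n x, B n ((u n : E n →L[ℂ] E n) x) = x := fun n x =>
    DFunLike.congr_fun (u n).inv_mul x
  have happ : ∀ n x, (u n : E n →L[ℂ] E n) x = z • x - A n x := fun n x => by
    rw [hu, sub_apply, Algebra.algebraMap_eq_smul_one, smul_apply, one_apply_eq_self]
  have htail : ∀ n, N ≤ n → ‖B n‖ ≤ 2 / ‖z‖ := by
    intro n hn
    refine ContinuousLinearMap.opNorm_le_bound _ (by positivity) fun y => ?_
    have h1 := huB n y
    rw [happ] at h1
    have h2 : ‖A n (B n y)‖ ≤ ‖z‖ / 2 * ‖B n y‖ :=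
      (A n).le_of_opNorm_le ((hA n).trans (hN n hn)) _
    have h3 := norm_sub_norm_le (z • B n y) (A n (B n y))
    rw [h1, norm_smul] at h3
    rw [div_mul_eq_mul_div, le_div_iff₀ hzpos]
    linarith
  have hbound : ∀ n, ‖B n‖ ≤ 2 / ‖z‖ + ∑ i ∈ Finset.range N, ‖B i‖ := by
    intro n
    have h1 : 0 ≤ ∑ i ∈ Finset.range N, ‖B i‖ := Finset.sum_nonneg fun _ _ => norm_nonneg _
    rcases lt_or_ge n N with hn | hn
    · have h2 := Finset.single_le_sum (f := fun i => ‖B i‖) (fun _ _ => norm_nonneg _)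
        (Finset.mem_range.2 hn)
      have h3 : 0 ≤ 2 / ‖z‖ := by positivity
      linarith
    · linarith [htail n hn]
  have hC : 0 ≤ 2 / ‖z‖ + ∑ i ∈ Finset.range N, ‖B i‖ := (norm_nonneg _).trans (hbound 0)
  have hMapp : ∀ (f : lp E 2) (k : ℕ),
      ((algebraMap ℂ (lp E 2 →L[ℂ] lp E 2) z - lp.mapCLM 2 A hK h) f : lp E 2) k
        = (u k : E k →L[ℂ] E k) (f k) := by
    intro f k
    simp only [happ, sub_apply, Algebra.algebraMap_eq_smul_one, smul_apply, one_apply_eq_self,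
      lp.coeFn_sub, Pi.sub_apply, lp.mapCLM_apply_coe, lp.coeFn_smul, Pi.smul_apply]
  rw [spectrum.mem_iff, ContinuousLinearMap.isUnit_iff_bijective] at hz
  refine hz ⟨fun f g hfg => lp.ext (funext fun k => ?_), fun g => ⟨lp.mapCLM 2 B hC hbound g, ?_⟩⟩
  · rw [← hBu k (f k), ← hMapp, hfg, hMapp, hBu]
  · refine lp.ext (funext fun k => ?_)
    rw [hMapp, lp.mapCLM_apply_coe, huB]

/-- The spectrum of a direct sum of operators with geometrically decreasing norms. -/
theorem spectrum_mapCLM_eq (A : ∀ n, E n →L[ℂ] E n) {K : ℝ} (hK : 0 ≤ K)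
    (h : ∀ n, ‖A n‖ ≤ K) {r : ℝ} (hr0 : 0 ≤ r) (hr : r < 1) (hA : ∀ n, ‖A n‖ ≤ r ^ n)
    (h0 : (0 : ℂ) ∈ closure (⋃ n ≥ 1, spectrum ℂ (A n))) :
    spectrum ℂ (lp.mapCLM 2 A hK h)
      = spectrum ℂ (A 0) ∪ closure (⋃ n ≥ 1, spectrum ℂ (A n)) := by
  refine Set.Subset.antisymm (fun z hz => ?_) (Set.union_subset
    (spectrum_subset_spectrum_mapCLM A hK h 0) (closure_minimal
      (Set.iUnion₂_subset fun n _ => spectrum_subset_spectrum_mapCLM A hK h n)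
      (spectrum.isClosed _)))
  by_cases hz0 : z = 0
  · rw [hz0]
    exact Or.inr h0
  · obtain ⟨n, hn⟩ := exists_mem_spectrum_of_mem_spectrum_mapCLM A hK h hr0 hr hA hz hz0
    rcases Nat.eq_zero_or_pos n with rfl | hpos
    · exact Or.inl hn
    · exact Or.inr (subset_closure (Set.mem_biUnion (show n ∈ {n | n ≥ 1} from hpos) hn))

end DirectSum

/-! ### Assembling the second quantizations -/

section

variable {H : Type u} [NormedAddCommGroup H] [InnerProductSpace ℂ H]

theorem norm_symTensorPowerMap_le (T : H →L[ℂ] H) (n : ℕ) :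
    ‖symTensorPowerMap T n‖ ≤ ‖T‖ ^ n :=
  ContinuousLinearMap.opNorm_le_bound _ (by positivity) fun x =>
    (tensorPowerMap T n).le_of_opNorm_le (norm_tensorPowerMap_le T n) (x : TensorPower H n)

/-- `0` is a limit of products of points of the spectrum of a strict contraction. -/
theorem zero_mem_closure_prod_spectrum [CompleteSpace H] [Nontrivial H] (T : H →L[ℂ] H)
    (hT : ‖T‖ < 1) : (0 : ℂ) ∈ closure (⋃ n ≥ 1,
      {z : ℂ | ∃ l : Fin n → ℂ, (∀ j, l j ∈ spectrum ℂ T) ∧ z = ∏ j, l j}) := by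
  obtain ⟨w, hw⟩ := spectrum.nonempty T
  have hw1 : ‖w‖ < 1 := (spectrum.norm_le_norm_of_mem hw).trans_lt hT
  refine mem_closure_of_tendsto (tendsto_pow_atTop_nhds_zero_of_norm_lt_one hw1)
    (Filter.eventually_atTop.2 ⟨1, fun n hn => ?_⟩)
  exact Set.mem_biUnion (show n ∈ {n | n ≥ 1} from hn) ⟨fun _ => w, fun _ => hw, by simp⟩

theorem setOf_prod_fin_zero (S : Set ℂ) :
    {z : ℂ | ∃ l : Fin 0 → ℂ, (∀ j, l j ∈ S) ∧ z = ∏ j, l j} = {1} := by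
  ext z
  simp

end

end FockSpace

end

theorem theorem3p4 {H : Type*} [NormedAddCommGroup H] [InnerProductSpace ℂ H] [CompleteSpace H]
    [Nontrivial H] (T : H →L[ℂ] H) (hT : ‖T‖ < 1) :
    spectrum ℂ (FockSpace.symSecondQuantization T hT.le)
        = spectrum ℂ (FockSpace.secondQuantization T hT.le) ∧
    spectrum ℂ (FockSpace.secondQuantization T hT.le)
        = {1} ∪ closure (⋃ n ≥ 1,
            {z : ℂ | ∃ l : Fin n → ℂ, (∀ j, l j ∈ spectrum ℂ T) ∧ z = ∏ j, l j}) := by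
  have h0 := FockSpace.zero_mem_closure_prod_spectrum T hT
  have h1 := FockSpace.spectrum_mapCLM_eq (fun n => FockSpace.tensorPowerMap T n) zero_le_one
    (FockSpace.norm_tensorPowerMap_le_one hT.le) (norm_nonneg T) hT
    (FockSpace.norm_tensorPowerMap_le T) (by simpa only [FockSpace.spectrum_tensorPowerMap] using h0)
  have h2 := FockSpace.spectrum_mapCLM_eq (fun n => FockSpace.symTensorPowerMap T n) zero_le_one
    (FockSpace.norm_symTensorPowerMap_le_one hT.le) (norm_nonneg T) hT
    (FockSpace.norm_symTensorPowerMap_le T)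
    (by simpa only [FockSpace.spectrum_symTensorPowerMap] using h0)
  -- For n = 0 the only product is the empty one, which turns the zeroth spectrum into {1}.
  simp only [FockSpace.spectrum_tensorPowerMap, FockSpace.setOf_prod_fin_zero] at h1
  simp only [FockSpace.spectrum_symTensorPowerMap, FockSpace.setOf_prod_fin_zero] at h2
  exact ⟨h2.trans h1.symm, h1⟩
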